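/- Let $\{X_t;\,t\in\mathbb Z\}$ be a zero mean, strictly stationary, real valued process, all of whose moments exist, such that for every $k=2,3,\dots$ $$\sum_{u_1,\dots,u_{k-1}=-\infty}^{\infty}\bigl|\mathrm{cum}(X_0,X_{u_1},\dots,X_{u_{k-1}})\bigr|<\infty ,$$ where $\mathrm{cum}$ denotes the joint cumulant. Let $R_X(h)=\mathrm{Cov}(X_{t+h},X_t)$, assume $\Sigma_X:=R_X(0)>0$, and let $F_X$ be the spectral distribution function of the process, i.e. the right continuous non-decreasing function on $[-\pi,\pi]$ with $F_X(-\pi)=0$ and $R_X(h)=\int_{(-\pi,\pi]}e^{-ih\omega}F_X(d\omega)$ for all $h\in\mathbb Z$. Suppose that $F_X$ has a density $f_X$ on $[-\pi,\pi]$ with $f_X\in\mathrm{Lip}(\alpha)$ for some $\alpha>1/2$, i.e. $|f_X(\omega)-f_X(\omega')|\le C|\omega-\omega'|^{\alpha}$ on $[-\pi,\pi]$ for some constant $C$. Let $0\le p\le 1$ and let $\lambda_p=\inf\{\omega\in[-\pi,\pi];\,F_X(\omega)\Sigma_X^{-1}\ge p\}$ be the $p$th quantile. Assume that it is unambiguous,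 in the sense that $F_X(\omega)\Sigma_X^{-1}>p$ for all $\omega\in(\lambda_p,\pi]$. For $n\ge1$ let $$I_{n,X}(\omega)=\frac1{2\pi n}\Bigl|\sum_{j=1}^nX_je^{ij\omega}\Bigr|^2,\qquad S_n(\theta)=\int_{-\pi}^{\pi}\rho_p(\omega-\theta)\,I_{n,X}(\omega)\,d\omega,\qquad \rho_p(u)=u\,(p-\mathbf 1(u<0)),$$ and let $\hat\lambda_{p,n}\in\arg\min_{\theta\in[-\pi,\pi]}S_n(\theta)$ be any minimizer. Then $\hat\lambda_{p,n}\to\lambda_p$ in probability as $n\to\infty$. -/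

import Mathlib

open MeasureTheory ProbabilityTheory Filter Set
open scoped NNReal ENNReal Real

noncomputable section

namespace SpectralQuantile

variable {Ω : Type*} [MeasurableSpace Ω]

/-- Joint cumulant of `Y 0, …, Y (k-1)`: the sum over all set partitions `P` of the index set of
`(-1) ^ (|P| - 1) * (|P| - 1)! * ∏_{B ∈ P} E[∏_{i ∈ B} Y i]`. -/
def jointCumulant (μ : Measure Ω) {k : ℕ} (Y : Fin k → Ω → ℝ) : ℝ :=
  ∑ P : Finpartition (Finset.univ : Finset (Fin k)),
    (-1 : ℝ) ^ (P.parts.card - 1) * ((P.parts.card - 1).factorial : ℝ) *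
      ∏ B ∈ P.parts, ∫ w, ∏ i ∈ B, Y i w ∂μ

/-- `cum(X_0, X_{u_1}, …, X_{u_m})`; for a strictly stationary process this is
`cum(X_t, X_{t+u_1}, …, X_{t+u_m})` for every `t`. -/
def processCumulant (μ : Measure Ω) (X : ℤ → Ω → ℝ) {m : ℕ} (u : Fin m → ℤ) : ℝ :=
  jointCumulant μ (fun i : Fin (m + 1) => X ((Fin.cons 0 u : Fin (m + 1) → ℤ) i))

/-- Strict stationarity: all finite-dimensional distributions are shift invariant
(`IdentDistrib` includes a.e. measurability). -/
def StrictlyStationary (μ : Measure Ω) (X : ℤ → Ω → ℝ) : Prop :=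
  ∀ (k : ℕ) (t : Fin k → ℤ) (h : ℤ),
    IdentDistrib (fun w i => X (t i + h) w) (fun w i => X (t i) w) μ μ

/-- A zero mean, strictly stationary real process, all of whose moments exist and all of whose
joint cumulants of order `k = m + 1 ≥ 2` are absolutely summable. -/
structure HasSummableCumulants (μ : Measure Ω) (X : ℤ → Ω → ℝ) : Prop where
  stationary : StrictlyStationary μ X
  moments : ∀ (t : ℤ) (k : ℕ), MemLp (X t) k μ
  zero_mean : ∀ t : ℤ, ∫ w, X t w ∂μ = 0
  summable : ∀ m : ℕ, 1 ≤ m → Summable (fun u : Fin m → ℤ => |processCumulant μ X u|)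

/-- Autocovariance function `R_X(h) = Cov(X_{t+h}, X_t)`, evaluated at `t = 0`. -/
def autocov (μ : Measure Ω) (X : ℤ → Ω → ℝ) (h : ℤ) : ℝ :=
  covariance (X h) (X 0) μ

/-- `F` is the spectral distribution function belonging to the autocovariance function `R`:
a right continuous non-decreasing function with `F (-π) = 0` and
`R h = ∫_{(-π, π]} exp (-i h ω) F(dω)` for all `h`. Only the values of `F` on `[-π, π]` matter. -/
structure IsSpectralDistribution (R : ℤ → ℝ) (F : StieltjesFunction ℝ) : Prop where
  left_end : F (-π) = 0
  fourier : ∀ h : ℤ,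
    (R h : ℂ) = ∫ ω in Ioc (-π) π, Complex.exp (-(Complex.I * (h : ℂ) * (ω : ℂ))) ∂F.measure

/-- `f` is a density of `F` on `[-π, π]` with respect to Lebesgue measure. -/
structure IsSpectralDensity (F : StieltjesFunction ℝ) (f : ℝ → ℝ) : Prop where
  integrable : IntegrableOn f (Icc (-π) π)
  integral_eq : ∀ ω ∈ Icc (-π) π, F ω = ∫ x in (-π)..ω, f x

/-- The `p`th quantile `inf {ω ∈ [-π, π] ; F(ω) Σ⁻¹ ≥ p}`, where `Sig` is the total mass `Σ`. -/
def quantile (F : StieltjesFunction ℝ) (Sig p : ℝ) : ℝ :=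
  sInf {ω : ℝ | ω ∈ Icc (-π) π ∧ p ≤ F ω * Sig⁻¹}

/-- The check function `ρ_p(u) = u (p - 1(u < 0))`. -/
def checkFn (p u : ℝ) : ℝ := u * (p - if u < 0 then 1 else 0)

/-- Periodogram `I_{n,X}(ω) = (2πn)⁻¹ |∑_{j=1}^n X_j exp(i j ω)|²` at the outcome `w`. -/
def periodogram (X : ℤ → Ω → ℝ) (n : ℕ) (w : Ω) (ω : ℝ) : ℝ :=
  1 / (2 * π * (n : ℝ)) *
    ‖∑ j ∈ Finset.Icc 1 n, (X (j : ℤ) w : ℂ) * Complex.exp (Complex.I * (j : ℂ) * (ω : ℂ))‖ ^ 2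

/-- Empirical objective `S_n(θ) = ∫_{-π}^{π} ρ_p(ω - θ) I_{n,X}(ω) dω` at the outcome `w`. -/
def empiricalObjective (X : ℤ → Ω → ℝ) (p : ℝ) (n : ℕ) (w : Ω) (θ : ℝ) : ℝ :=
  ∫ ω in (-π)..π, checkFn p (ω - θ) * periodogram X n w ω

/-- `est n w` is a minimizer of `S_n` over `[-π, π]`, for every sample size `n ≥ 1` and every
outcome `w`. No particular (or measurable) choice among several minimizers is required. -/
def IsQuantileEstimator (X : ℤ → Ω → ℝ) (p : ℝ) (est : ℕ → Ω → ℝ) : Prop :=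
  ∀ n : ℕ, 1 ≤ n → ∀ w : Ω,
    est n w ∈ Icc (-π) π ∧ IsMinOn (empiricalObjective X p n w) (Icc (-π) π) (est n w)

end SpectralQuantile

end

noncomputable section

namespace SpectralQuantile

variable {Ω : Type*} [MeasurableSpace Ω]

/-! ### Partitions without singletons and low order cumulants -/

/-! The objective is a convex function of `θ`: the check function integrated against the random
measure with density the periodogram. At any fixed `x` the subgradient is the mass of `(-π, x]`
minus `p` times the total mass, and its sign tells on which side of `x` a minimizer can lie. So two
points on either side of the quantile suffice; no uniform convergence of `S_n` is needed
(`integral_checkFn_subgradient`, `IsQuantileEstimator.mul_le_zero`).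

The signs come from weak convergence. The Fourier coefficients of the periodogram measure are the
sample autocovariances (`fourier_periodogramMeasure`). These are consistent by Chebyshev: summable
second and fourth order cumulants make the variance of a sum of `n` lagged products `O(n)`
(`exists_integral_sq_sum_le`). Trigonometric polynomials are dense in the continuous functions on
the circle, so convergence of coefficients gives asymptotic lower bounds for interval masses
(`eventually_lt_measureReal_Ioc`). Lower bounds are enough: `(-π, x]` is used right of the quantile,
`(x, π]` left of it.

Convergence in probability is encoded by the filter `inMeasure`, so deterministic limit arguments
apply verbatim and the estimator need not be measurable. -/

/-- A partition of `Fin 4` without singleton blocks is trivial or consists of two pairs. -/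
theorem finpartition_fin_four_parts (P : Finpartition (Finset.univ : Finset (Fin 4)))
    (hP : ∀ i, {i} ∉ P.parts) :
    P.parts = {Finset.univ} ∨
      ∃ B : Finset (Fin 4), 0 ∈ B ∧ B.card = 2 ∧ P.parts = {B, Bᶜ} := by
  have hcard : ∀ B ∈ P.parts, 2 ≤ B.card := by
    intro B hB
    have h1 : 0 < B.card := (P.nonempty_of_mem_parts hB).card_pos
    have h2 : B.card ≠ 1 := by
      intro h
      obtain ⟨i, rfl⟩ := Finset.card_eq_one.1 h
      exact hP i hB
    omega
  have hB : P.part 0 ∈ P.parts := P.part_mem.2 (Finset.mem_univ _)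
  have h0 : (0 : Fin 4) ∈ P.part 0 := P.mem_part_self.2 (Finset.mem_univ _)
  set B := P.part 0
  by_cases hBu : B = Finset.univ
  · left
    ext C
    rw [Finset.mem_singleton]
    constructor
    · intro hC
      obtain ⟨i, hi⟩ := P.nonempty_of_mem_parts hC
      rw [P.eq_of_mem_parts hC hB hi (by simp [hBu]), hBu]
    · intro hC
      exact hC.trans hBu.symm ▸ hB
  · right
    -- Two disjoint blocks with at least two elements each already exhaust four points.
    have key : ∀ C ∈ P.parts, C ≠ B → C = Bᶜ ∧ B.card = 2 := by
      intro C hC hne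
      have hd : Disjoint C B := P.disjoint hC hB hne
      have hsub : C ⊆ Bᶜ := Finset.subset_compl_iff_disjoint_right.2 hd
      have h1 := Finset.card_compl B
      have h2 := hcard C hC
      have h3 := hcard B hB
      have h4 := Finset.card_le_card hsub
      rw [Fintype.card_fin] at h1
      exact ⟨Finset.eq_of_subset_of_card_le hsub (by omega), by omega⟩
    obtain ⟨k, hk⟩ : ∃ k, k ∉ B := by
      by_contra! h
      exact hBu (Finset.eq_univ_iff_forall.2 h)
    have hC : P.part k ∈ P.parts := P.part_mem.2 (Finset.mem_univ _)
    have hkC : k ∈ P.part k := P.mem_part_self.2 (Finset.mem_univ _)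
    obtain ⟨hCB, hcB⟩ := key _ hC (fun h => hk (h ▸ hkC))
    refine ⟨B, h0, hcB, ?_⟩
    ext C
    rw [Finset.mem_insert, Finset.mem_singleton]
    constructor
    · intro hC
      by_cases h : C = B
      · exact Or.inl h
      · exact Or.inr (key C hC h).1
    · rintro (rfl | rfl)
      · exact hB
      · exact hCB ▸ hC

/-- In a cumulant of centered variables, partitions with a singleton block do not contribute. -/
theorem prod_parts_eq_zero (μ : Measure Ω) {k : ℕ} {Y : Fin k → Ω → ℝ}
    (hY : ∀ i, ∫ w, Y i w ∂μ = 0) {S : Finset (Finset (Fin k))} {i : Fin k} (hi : {i} ∈ S) :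
    ∏ B ∈ S, ∫ w, ∏ i ∈ B, Y i w ∂μ = 0 :=
  Finset.prod_eq_zero hi (by simpa using hY i)

/-- Centering kills every partition with a singleton block. What survives is the one-block
partition, with coefficient `1`, and the three pairings, with coefficient `-1`. -/
theorem jointCumulant_four (μ : Measure Ω) {Y : Fin 4 → Ω → ℝ}
    (hY : ∀ i, ∫ w, Y i w ∂μ = 0) :
    jointCumulant μ Y = ∫ w, Y 0 w * Y 1 w * (Y 2 w * Y 3 w) ∂μ
      - (∫ w, Y 0 w * Y 1 w ∂μ) * (∫ w, Y 2 w * Y 3 w ∂μ)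
      - (∫ w, Y 0 w * Y 2 w ∂μ) * (∫ w, Y 1 w * Y 3 w ∂μ)
      - (∫ w, Y 0 w * Y 3 w ∂μ) * (∫ w, Y 1 w * Y 2 w ∂μ) := by
  let Q₀ : Finpartition (Finset.univ : Finset (Fin 4)) :=
    ⟨{Finset.univ}, by decide, by decide, by decide⟩
  let Q₁ : Finpartition (Finset.univ : Finset (Fin 4)) :=
    ⟨{{0, 1}, {2, 3}}, by decide, by decide, by decide⟩
  let Q₂ : Finpartition (Finset.univ : Finset (Fin 4)) :=
    ⟨{{0, 2}, {1, 3}}, by decide, by decide, by decide⟩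
  let Q₃ : Finpartition (Finset.univ : Finset (Fin 4)) :=
    ⟨{{0, 3}, {1, 2}}, by decide, by decide, by decide⟩
  have ne_of_parts : ∀ {P Q : Finpartition (Finset.univ : Finset (Fin 4))},
      P.parts ≠ Q.parts → P ≠ Q := fun h h' => h (h' ▸ rfl)
  have h01 : Q₀ ≠ Q₁ := ne_of_parts (by decide)
  have h02 : Q₀ ≠ Q₂ := ne_of_parts (by decide)
  have h03 : Q₀ ≠ Q₃ := ne_of_parts (by decide)
  have h12 : Q₁ ≠ Q₂ := ne_of_parts (by decide)
  have h13 : Q₁ ≠ Q₃ := ne_of_parts (by decide)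
  have h23 : Q₂ ≠ Q₃ := ne_of_parts (by decide)
  classical
  have hpairs : ∀ B : Finset (Fin 4), 0 ∈ B → B.card = 2 →
      ({B, Bᶜ} : Finset (Finset (Fin 4))) = {{0, 1}, {2, 3}} ∨
      ({B, Bᶜ} : Finset (Finset (Fin 4))) = {{0, 2}, {1, 3}} ∨
      ({B, Bᶜ} : Finset (Finset (Fin 4))) = {{0, 3}, {1, 2}} := by decide
  unfold jointCumulant
  rw [← Finset.sum_subset (Finset.subset_univ {Q₀, Q₁, Q₂, Q₃})]
  · rw [Finset.sum_insert (by simp [h01, h02, h03]), Finset.sum_insert (by simp [h12, h13]),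
      Finset.sum_insert (by simp [h23]), Finset.sum_singleton]
    have e₁ : ({{0, 1}, {2, 3}} : Finset (Finset (Fin 4))).card = 2 := by decide
    have e₂ : ({{0, 2}, {1, 3}} : Finset (Finset (Fin 4))).card = 2 := by decide
    have e₃ : ({{0, 3}, {1, 2}} : Finset (Finset (Fin 4))).card = 2 := by decide
    have n₁ : ({0, 1} : Finset (Fin 4)) ∉ ({{2, 3}} : Finset (Finset (Fin 4))) := by decide
    have n₂ : ({0, 2} : Finset (Fin 4)) ∉ ({{1, 3}} : Finset (Finset (Fin 4))) := by decide
    have n₃ : ({0, 3} : Finset (Fin 4)) ∉ ({{1, 2}} : Finset (Finset (Fin 4))) := by decide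
    simp only [Q₀, Q₁, Q₂, Q₃, e₁, e₂, e₃, Finset.prod_insert n₁, Finset.prod_insert n₂,
      Finset.prod_insert n₃, Finset.prod_singleton, Finset.card_singleton, Fin.prod_univ_four]
    have p : ∀ (i j : Fin 4) (w : Ω), i ≠ j → ∏ l ∈ ({i, j} : Finset (Fin 4)), Y l w
        = Y i w * Y j w := fun i j w h => Finset.prod_pair h
    simp only [p 0 1 _ (by decide), p 2 3 _ (by decide), p 0 2 _ (by decide),
      p 1 3 _ (by decide), p 0 3 _ (by decide), p 1 2 _ (by decide)]
    norm_num [Nat.factorial]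
    simp only [mul_assoc]
    ring
  · intro P _ hP
    simp only [Finset.mem_insert, Finset.mem_singleton, not_or] at hP
    obtain ⟨hP0, hP1, hP2, hP3⟩ := hP
    suffices h : ∃ i, {i} ∈ P.parts by
      obtain ⟨i, hi⟩ := h
      rw [prod_parts_eq_zero μ hY hi, mul_zero]
    by_contra! h
    rcases finpartition_fin_four_parts P h with h | ⟨B, hB, hc, h⟩
    · exact hP0 (Finpartition.ext h)
    · rcases hpairs B hB hc with h' | h' | h'
      · exact hP1 (Finpartition.ext (h.trans h'))
      · exact hP2 (Finpartition.ext (h.trans h'))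
      · exact hP3 (Finpartition.ext (h.trans h'))

theorem jointCumulant_two (μ : Measure Ω) {Y : Fin 2 → Ω → ℝ}
    (hY : ∀ i, ∫ w, Y i w ∂μ = 0) :
    jointCumulant μ Y = ∫ w, Y 0 w * Y 1 w ∂μ := by
  let Q : Finpartition (Finset.univ : Finset (Fin 2)) :=
    ⟨{Finset.univ}, by decide, by decide, by decide⟩
  unfold jointCumulant
  rw [Finset.sum_eq_single Q]
  · simp [Q]
  · intro P _ hP
    suffices h : ∃ i, {i} ∈ P.parts by
      obtain ⟨i, hi⟩ := h
      rw [prod_parts_eq_zero μ hY hi, mul_zero]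
    by_contra! h
    apply hP
    apply Finpartition.ext
    have hfull : ∀ B ∈ P.parts, B = Finset.univ := by
      intro B hB
      have h1 : B ≠ ∅ := P.ne_empty hB
      have h2 : B ≠ {0} := fun h' => h 0 (h' ▸ hB)
      have h3 : B ≠ {1} := fun h' => h 1 (h' ▸ hB)
      clear hB
      revert h1 h2 h3
      revert B
      decide
    exact Finset.eq_singleton_iff_nonempty_unique_mem.2
      ⟨P.parts_nonempty (by decide), hfull⟩
  · simp

/-! ### Second and fourth order moments -/

variable {μ : Measure Ω} {X : ℤ → Ω → ℝ}

namespace HasSummableCumulants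

/-- Hölder with exponents `4, 4, 2`, from the fourth moments. -/
theorem memLp_mul (hX : HasSummableCumulants μ X) (i j : ℤ) :
    MemLp (fun w => X i w * X j w) 2 μ := by
  have h : ENNReal.HolderTriple 4 4 2 := by
    refine ⟨?_⟩
    have h4 : (4 : ℝ≥0∞) = 2 * 2 := by norm_num
    rw [h4, ENNReal.mul_inv (by simp) (by simp), ← mul_add, ENNReal.inv_two_add_inv_two, mul_one]
  have h1 : MemLp (X i) 4 μ := by simpa using hX.moments i 4
  have h2 : MemLp (X j) 4 μ := by simpa using hX.moments j 4
  exact MemLp.mul' (r := 2) h2 h1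

theorem integrable_mul [IsFiniteMeasure μ] (hX : HasSummableCumulants μ X) (i j : ℤ) :
    Integrable (fun w => X i w * X j w) μ :=
  (hX.memLp_mul i j).integrable (by norm_num)

theorem integral_mul_shift (hX : HasSummableCumulants μ X) (i j h : ℤ) :
    ∫ w, X (i + h) w * X (j + h) w ∂μ = ∫ w, X i w * X j w ∂μ := by
  have := (hX.stationary 2 ![i, j] h).comp
    (u := fun v : Fin 2 → ℝ => v 0 * v 1) (by fun_prop)
  simpa [Function.comp_def] using this.integral_eq

theorem integral_mul_mul_shift (hX : HasSummableCumulants μ X) (i j k l h : ℤ) :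
    ∫ w, X (i + h) w * X (j + h) w * (X (k + h) w * X (l + h) w) ∂μ
      = ∫ w, X i w * X j w * (X k w * X l w) ∂μ := by
  have := (hX.stationary 4 ![i, j, k, l] h).comp
    (u := fun v : Fin 4 → ℝ => v 0 * v 1 * (v 2 * v 3)) (by fun_prop)
  simpa [Function.comp_def] using this.integral_eq

theorem autocov_eq [IsProbabilityMeasure μ] (hX : HasSummableCumulants μ X) (h : ℤ) :
    autocov μ X h = ∫ w, X 0 w * X h w ∂μ := by
  rw [autocov, covariance]
  simp [hX.zero_mean, mul_comm]

theorem integral_mul_eq_autocov [IsProbabilityMeasure μ] (hX : HasSummableCumulants μ X)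
    (i j : ℤ) : ∫ w, X i w * X j w ∂μ = autocov μ X (j - i) := by
  rw [hX.autocov_eq, ← hX.integral_mul_shift 0 (j - i) i]
  simp

theorem summable_autocov [IsProbabilityMeasure μ] (hX : HasSummableCumulants μ X) :
    Summable (fun h => |autocov μ X h|) := by
  have h := (hX.summable 1 le_rfl).comp_injective (Equiv.funUnique (Fin 1) ℤ).symm.injective
  refine h.congr fun u => ?_
  rw [Function.comp_apply, processCumulant, jointCumulant_two μ (fun i => hX.zero_mean _),
    hX.autocov_eq]
  rfl

/-- Summability of the autocovariances of the lagged products `X_s X_{s+h}`. -/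
theorem summable_cov_mul [IsProbabilityMeasure μ] (hX : HasSummableCumulants μ X) (h : ℤ) :
    Summable (fun s => |∫ w, X 0 w * X h w * (X s w * X (s + h) w) ∂μ - autocov μ X h ^ 2|) := by
  set γ := autocov μ X with hγ
  have hs := hX.summable_autocov
  have hbound : ∀ s, |γ s| ≤ ∑' u, |γ u| := fun s => hs.le_tsum s (fun _ _ => abs_nonneg _)
  -- The triples `(h, s, s + h)` form an injective slice of the index set of the fourth order
  -- cumulants.
  have hcum : Summable (fun s : ℤ => |processCumulant μ X ![h, s, s + h]|) := by
    refine (hX.summable 3 (by norm_num)).comp_injective (i := fun s : ℤ => ![h, s, s + h]) ?_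
    intro s t hst
    simpa using congrFun hst 1
  -- One factor is bounded by the full sum, the other is summable.
  have hprod : ∀ a b : ℤ, Summable (fun s : ℤ => |γ (s + a)| * |γ (s + b)|) := by
    intro a b
    have h1 : Summable (fun s : ℤ => |γ (s + a)| * ∑' u, |γ u|) :=
      (hs.comp_injective (add_left_injective a)).mul_right _
    exact h1.of_nonneg_of_le (fun s => by positivity)
      (fun s => mul_le_mul_of_nonneg_left (hbound _) (abs_nonneg _))
  refine ((hcum.add (hprod 0 0)).add (hprod h (-h))).of_nonneg_of_le (fun s => abs_nonneg _) ?_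
  intro s
  have e : ∫ w, X 0 w * X h w * (X s w * X (s + h) w) ∂μ - γ h ^ 2
      = processCumulant μ X ![h, s, s + h] + γ (s + 0) * γ (s + 0) + γ (s + h) * γ (s + -h) := by
    rw [processCumulant, jointCumulant_four μ (fun i => hX.zero_mean _)]
    have e1 : ∫ w, X 0 w * X h w ∂μ = γ h := by simp [hX.integral_mul_eq_autocov, hγ]
    have e2 : ∫ w, X s w * X (s + h) w ∂μ = γ h := by simp [hX.integral_mul_eq_autocov, hγ]
    have e3 : ∫ w, X 0 w * X s w ∂μ = γ s := by simp [hX.integral_mul_eq_autocov, hγ]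
    have e4 : ∫ w, X h w * X (s + h) w ∂μ = γ s := by simp [hX.integral_mul_eq_autocov, hγ]
    have e5 : ∫ w, X 0 w * X (s + h) w ∂μ = γ (s + h) := by
      simp [hX.integral_mul_eq_autocov, hγ]
    have e6 : ∫ w, X h w * X s w ∂μ = γ (s - h) := by simp [hX.integral_mul_eq_autocov, hγ]
    have c0 : (Fin.cons 0 ![h, s, s + h] : Fin 4 → ℤ) 0 = 0 := rfl
    have c1 : (Fin.cons 0 ![h, s, s + h] : Fin 4 → ℤ) 1 = h := rfl
    have c2 : (Fin.cons 0 ![h, s, s + h] : Fin 4 → ℤ) 2 = s := rfl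
    have c3 : (Fin.cons 0 ![h, s, s + h] : Fin 4 → ℤ) 3 = s + h := rfl
    simp only [c0, c1, c2, c3, e1, e2, e3, e4, e5, e6, add_zero, ← sub_eq_add_neg]
    ring
  rw [e, ← abs_mul, ← abs_mul]
  exact abs_add_three _ _ _

/-- Second moment bound for centered sums of lagged products. -/
theorem exists_integral_sq_sum_le [IsProbabilityMeasure μ] (hX : HasSummableCumulants μ X)
    (h : ℤ) : ∃ C : ℝ, ∀ J : Finset ℤ,
      ∫ w, (∑ j ∈ J, (X j w * X (j + h) w - autocov μ X h)) ^ 2 ∂μ ≤ J.card * C := by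
  set γ := autocov μ X h with hγ
  set c : ℤ → ℝ := fun s => ∫ w, X 0 w * X h w * (X s w * X (s + h) w) ∂μ - γ ^ 2 with hc
  have hsum : Summable (fun s => |c s|) := hX.summable_cov_mul h
  have hL2 : ∀ j, MemLp (fun w => X j w * X (j + h) w - γ) 2 μ := fun j =>
    (hX.memLp_mul j (j + h)).sub (memLp_const γ)
  have hint : ∀ j k, Integrable (fun w => (X j w * X (j + h) w - γ) *
      (X k w * X (k + h) w - γ)) μ := fun j k => (hL2 j).integrable_mul (hL2 k)
  -- By stationarity the covariance of two lagged products depends only on `k - j`.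
  have hcov : ∀ j k, ∫ w, (X j w * X (j + h) w - γ) * (X k w * X (k + h) w - γ) ∂μ
      = c (k - j) := by
    intro j k
    have i1 : Integrable (fun w => X j w * X (j + h) w * (X k w * X (k + h) w)) μ :=
      (hX.memLp_mul j (j + h)).integrable_mul (hX.memLp_mul k (k + h))
    have i2 := (hX.integrable_mul j (j + h)).const_mul γ
    have i3 := (hX.integrable_mul k (k + h)).const_mul γ
    have e : ∀ w, (X j w * X (j + h) w - γ) * (X k w * X (k + h) w - γ)
        = X j w * X (j + h) w * (X k w * X (k + h) w) - γ * (X j w * X (j + h) w)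
          - γ * (X k w * X (k + h) w) + γ ^ 2 := fun w => by ring
    simp_rw [e]
    rw [integral_add (by exact (i1.sub i2).sub i3) (integrable_const _),
      integral_sub (by exact i1.sub i2) i3,
      integral_sub i1 i2, integral_const_mul, integral_const_mul, hX.integral_mul_eq_autocov,
      hX.integral_mul_eq_autocov]
    simp only [add_sub_cancel_left, ← hγ, integral_const, probReal_univ, one_smul, hc]
    rw [← hX.integral_mul_mul_shift 0 h (k - j) (k - j + h) j]
    have a1 : h + j = j + h := add_comm _ _
    have a2 : k - j + h + j = k + h := by ring
    simp only [zero_add, sub_add_cancel, a1, a2]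
    ring
  refine ⟨∑' s, |c s|, fun J => ?_⟩
  have e : ∀ w, (∑ j ∈ J, (X j w * X (j + h) w - γ)) ^ 2
      = ∑ j ∈ J, ∑ k ∈ J, (X j w * X (j + h) w - γ) * (X k w * X (k + h) w - γ) := fun w => by
    rw [sq, Finset.sum_mul_sum]
  simp_rw [e]
  rw [integral_finsetSum _ (fun j _ => integrable_finsetSum _ (fun k _ => hint j k)),
    ← nsmul_eq_mul]
  -- Each row of the double sum is bounded by the whole series, so the bound is linear in `J.card`
  -- instead of quadratic.
  refine Finset.sum_le_card_nsmul _ _ _ fun j _ => ?_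
  rw [integral_finsetSum _ (fun k _ => hint j k)]
  simp_rw [hcov]
  calc ∑ k ∈ J, c (k - j) ≤ ∑ k ∈ J, |c (k - j)| := Finset.sum_le_sum fun k _ => le_abs_self _
    _ = ∑ s ∈ J.map ⟨fun k => k - j, sub_left_injective⟩, |c s| := by simp
    _ ≤ ∑' s, |c s| := hsum.sum_le_tsum _ (fun _ _ => abs_nonneg _)

end HasSummableCumulants

end SpectralQuantile

end

noncomputable section

namespace SpectralQuantile

/-! ### Convergence of measures on the circle from convergence of Fourier coefficients -/

open Topology

instance fact_two_pi_pos : Fact (0 < 2 * π) := ⟨Real.two_pi_pos⟩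

theorem integrable_circle (ν : Measure ℝ) [IsFiniteMeasure ν] (g : C(AddCircle (2 * π), ℂ)) :
    Integrable (fun ω : ℝ => g (ω : AddCircle (2 * π))) ν :=
  Integrable.of_bound
    (g.continuous.comp (AddCircle.continuous_mk' (2 * π))).aestronglyMeasurable ‖g‖
    (ae_of_all _ fun _ => g.norm_coe_le_norm _)

/-- If all Fourier coefficients converge along a filter, so do the integrals of all continuous
periodic functions. -/
theorem tendsto_integral_circle {ι : Type*} {l : Filter ι} {η : ι → Measure ℝ}
    [∀ i, IsFiniteMeasure (η i)] {ν : Measure ℝ} [IsFiniteMeasure ν]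
    (h : ∀ k : ℤ, Tendsto (fun i => ∫ ω : ℝ, Complex.exp (-(Complex.I * (k : ℂ) * (ω : ℂ))) ∂η i) l
      (𝓝 (∫ ω : ℝ, Complex.exp (-(Complex.I * (k : ℂ) * (ω : ℂ))) ∂ν)))
    (g : C(AddCircle (2 * π), ℂ)) :
    Tendsto (fun i => ∫ ω : ℝ, g (ω : AddCircle (2 * π)) ∂η i) l
      (𝓝 (∫ ω : ℝ, g (ω : AddCircle (2 * π)) ∂ν)) := by
  have hspan : ∀ q ∈ Submodule.span ℂ (range (@fourier (2 * π))),
      Tendsto (fun i => ∫ ω : ℝ, q (ω : AddCircle (2 * π)) ∂η i) l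
        (𝓝 (∫ ω : ℝ, q (ω : AddCircle (2 * π)) ∂ν)) := by
    intro q hq
    induction hq using Submodule.span_induction with
    | mem q hq =>
      obtain ⟨k, rfl⟩ := hq
      have e : ∀ ω : ℝ, fourier k (ω : AddCircle (2 * π))
          = Complex.exp (-(Complex.I * ((-k : ℤ) : ℂ) * (ω : ℂ))) := by
        intro ω
        rw [fourier_coe_apply]
        congr 1
        have : (π : ℂ) ≠ 0 := by exact_mod_cast Real.pi_ne_zero
        push_cast
        field_simp
      simp_rw [e]
      exact h (-k)
    | zero => simpa using tendsto_const_nhds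
    | add q r _ _ hq hr =>
      have e : ∀ (ν : Measure ℝ) [IsFiniteMeasure ν],
          ∫ ω : ℝ, (q + r) (ω : AddCircle (2 * π)) ∂ν
            = ∫ ω : ℝ, q (ω : AddCircle (2 * π)) ∂ν + ∫ ω : ℝ, r (ω : AddCircle (2 * π)) ∂ν :=
        fun ν _ => integral_add (integrable_circle ν q) (integrable_circle ν r)
      simp_rw [e]
      exact hq.add hr
    | smul c q _ hq =>
      have e : ∀ (ν : Measure ℝ), ∫ ω : ℝ, (c • q) (ω : AddCircle (2 * π)) ∂ν
            = c • ∫ ω : ℝ, q (ω : AddCircle (2 * π)) ∂ν := fun ν => integral_smul c _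
      simp_rw [e]
      exact hq.const_smul c
  -- The coefficient at `0` is the total mass; its convergence keeps the masses eventually below `M
  -- + 1`.
  have hmass : Tendsto (fun i => (η i).real univ) l (𝓝 (ν.real univ)) := by
    have h0 := (Complex.continuous_re.tendsto _).comp (h 0)
    simpa [Function.comp_def] using h0
  rw [Metric.tendsto_nhds]
  intro ε hε
  set M := ν.real univ
  have hM : 0 ≤ M := measureReal_nonneg
  have hg : g ∈ closure (Submodule.span ℂ (range (@fourier (2 * π))) : Set _) := by
    rw [← Submodule.topologicalClosure_coe, span_fourier_closure_eq_top]
    trivial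
  -- With this tolerance, replacing `g` by `q` costs at most `ε / 4` under `ν` and under every
  -- measure of mass at most `M + 1`.
  obtain ⟨q, hq, hqg⟩ := Metric.mem_closure_iff.1 hg (ε / (4 * (M + 1))) (by positivity)
  rw [dist_eq_norm] at hqg
  have happrox : ∀ (ν : Measure ℝ) [IsFiniteMeasure ν],
      ‖∫ ω : ℝ, g (ω : AddCircle (2 * π)) ∂ν - ∫ ω : ℝ, q (ω : AddCircle (2 * π)) ∂ν‖
        ≤ ε / (4 * (M + 1)) * ν.real univ := by
    intro ν _
    rw [← integral_sub (integrable_circle ν g) (integrable_circle ν q)]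
    exact norm_integral_le_of_norm_le_const
      (ae_of_all _ fun ω => ((g - q).norm_coe_le_norm _).trans hqg.le)
  filter_upwards [Metric.tendsto_nhds.1 (hspan q hq) (ε / 2) (by positivity),
    hmass.eventually_lt_const (lt_add_one M)] with i hi hiM
  have h1 := happrox (η i)
  have h2 := happrox ν
  rw [dist_eq_norm] at hi ⊢
  have h3 : ε / (4 * (M + 1)) * (η i).real univ ≤ ε / 4 := by
    calc ε / (4 * (M + 1)) * (η i).real univ ≤ ε / (4 * (M + 1)) * (M + 1) := by gcongr
      _ = ε / 4 := by field_simp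
  have h4 : ε / (4 * (M + 1)) * M < ε / 4 := by
    calc ε / (4 * (M + 1)) * M < ε / (4 * (M + 1)) * (M + 1) := by gcongr; linarith
      _ = ε / 4 := by field_simp
  set A := ∫ ω : ℝ, g (ω : AddCircle (2 * π)) ∂η i
  set B := ∫ ω : ℝ, q (ω : AddCircle (2 * π)) ∂η i
  set C := ∫ ω : ℝ, q (ω : AddCircle (2 * π)) ∂ν
  set D := ∫ ω : ℝ, g (ω : AddCircle (2 * π)) ∂ν
  have h5 : ‖A - D‖ ≤ ‖A - B‖ + ‖B - C‖ + ‖D - C‖ := by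
    have : A - D = (A - B) + (B - C) - (D - C) := by ring
    rw [this]
    exact (norm_sub_le _ _).trans (by gcongr; exact norm_add_le _ _)
  linarith

/-! ### Interval masses via continuous bump functions -/

/-- The trapezoidal bump function on `[a, b]` with slopes `1 / d`. -/
def trapezoid (a b d ω : ℝ) : ℝ := min 1 (max 0 (min (ω - a) (b - ω)) / d)

theorem continuous_trapezoid (a b d : ℝ) : Continuous (trapezoid a b d) := by
  unfold trapezoid
  fun_prop

theorem trapezoid_nonneg {d : ℝ} (hd : 0 < d) (a b ω : ℝ) : 0 ≤ trapezoid a b d ω := by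
  unfold trapezoid
  positivity

theorem trapezoid_le_one (a b d ω : ℝ) : trapezoid a b d ω ≤ 1 := min_le_left _ _

theorem trapezoid_eq_zero (a b d : ℝ) {ω : ℝ} (h : ω ≤ a ∨ b ≤ ω) : trapezoid a b d ω = 0 := by
  have : min (ω - a) (b - ω) ≤ 0 := by
    rcases h with h | h
    · exact (min_le_left _ _).trans (by linarith)
    · exact (min_le_right _ _).trans (by linarith)
  simp [trapezoid, max_eq_left this]

theorem trapezoid_eq_one {a b d ω : ℝ} (hd : 0 < d) (ha : a + d ≤ ω) (hb : ω ≤ b - d) :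
    trapezoid a b d ω = 1 := by
  have h1 : d ≤ min (ω - a) (b - ω) := le_min (by linarith) (by linarith)
  exact min_eq_left ((one_le_div hd).2 (h1.trans (le_max_right _ _)))

theorem integrable_trapezoid (ν : Measure ℝ) [IsFiniteMeasure ν] (a b : ℝ) {d : ℝ} (hd : 0 < d) :
    Integrable (trapezoid a b d) ν :=
  Integrable.of_bound (continuous_trapezoid a b d).aestronglyMeasurable 1
    (ae_of_all _ fun ω => by
      rw [Real.norm_of_nonneg (trapezoid_nonneg hd a b ω)]
      exact trapezoid_le_one a b d ω)

theorem integral_trapezoid_le (ν : Measure ℝ) [IsFiniteMeasure ν] (a b : ℝ) {d : ℝ}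
    (hd : 0 < d) : ∫ ω, trapezoid a b d ω ∂ν ≤ ν.real (Ioc a b) := by
  rw [← integral_indicator_one measurableSet_Ioc]
  refine integral_mono (integrable_trapezoid ν a b hd)
    ((integrable_indicator_iff measurableSet_Ioc).2 (integrableOn_const (by finiteness))) fun ω => ?_
  by_cases h : ω ∈ Ioc a b
  · simpa [h] using trapezoid_le_one a b d ω
  · have : ω ≤ a ∨ b ≤ ω := by
      by_contra! hc
      exact h ⟨hc.1, hc.2.le⟩
    simp [h, trapezoid_eq_zero a b d this]

theorem le_integral_trapezoid (ν : Measure ℝ) [IsFiniteMeasure ν] (a b : ℝ) {d : ℝ}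
    (hd : 0 < d) : ν.real (Ioc (a + d) (b - d)) ≤ ∫ ω, trapezoid a b d ω ∂ν := by
  rw [← integral_indicator_one measurableSet_Ioc]
  refine integral_mono
    ((integrable_indicator_iff measurableSet_Ioc).2 (integrableOn_const (by finiteness)))
    (integrable_trapezoid ν a b hd) fun ω => ?_
  by_cases h : ω ∈ Ioc (a + d) (b - d)
  · simp [h, trapezoid_eq_one hd h.1.le h.2]
  · simpa [h] using trapezoid_nonneg hd a b ω

/-- For `[a, b]` inside `[-π, π]` the trapezoid vanishes at both `-π` and `π`, so it descends to a
continuous function on the circle. -/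
theorem tendsto_integral_trapezoid {ι : Type*} {l : Filter ι} {η : ι → Measure ℝ}
    [∀ i, IsFiniteMeasure (η i)] (hη : ∀ i, ∀ᵐ ω ∂η i, ω ∈ Ioc (-π) π)
    {ν : Measure ℝ} [IsFiniteMeasure ν] (hν : ∀ᵐ ω ∂ν, ω ∈ Ioc (-π) π)
    (h : ∀ k : ℤ, Tendsto (fun i => ∫ ω : ℝ, Complex.exp (-(Complex.I * (k : ℂ) * (ω : ℂ))) ∂η i) l
      (𝓝 (∫ ω : ℝ, Complex.exp (-(Complex.I * (k : ℂ) * (ω : ℂ))) ∂ν)))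
    {a b : ℝ} (ha : -π ≤ a) (hb : b ≤ π) (d : ℝ) :
    Tendsto (fun i => ∫ ω, trapezoid a b d ω ∂η i) l (𝓝 (∫ ω, trapezoid a b d ω ∂ν)) := by
  have hper : -π + 2 * π = π := by ring
  let g : C(AddCircle (2 * π), ℂ) :=
    ⟨AddCircle.liftIoc (2 * π) (-π) (fun ω => (trapezoid a b d ω : ℂ)), by
      refine AddCircle.liftIoc_continuous ?_
        (Complex.continuous_ofReal.comp (continuous_trapezoid a b d)).continuousOn
      rw [hper, trapezoid_eq_zero a b d (Or.inl ha), trapezoid_eq_zero a b d (Or.inr hb)]⟩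
  have e : ∀ ν : Measure ℝ, (∀ᵐ ω ∂ν, ω ∈ Ioc (-π) π) →
      (∫ ω : ℝ, g (ω : AddCircle (2 * π)) ∂ν).re = ∫ ω, trapezoid a b d ω ∂ν := by
    intro ν hν
    rw [integral_congr_ae (g := fun ω => ((trapezoid a b d ω : ℝ) : ℂ)), integral_complex_ofReal,
      Complex.ofReal_re]
    filter_upwards [hν] with ω hω
    exact AddCircle.liftIoc_coe_apply (f := fun ω => (trapezoid a b d ω : ℂ)) (by rwa [hper])
  have := (Complex.continuous_re.tendsto _).comp (tendsto_integral_circle h g)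
  simp only [Function.comp_def] at this
  rw [e ν hν] at this
  exact this.congr fun i => e _ (hη i)

/-- Asymptotic lower bound for the mass of an interval in terms of a continuous limit
distribution function. -/
theorem eventually_lt_measureReal_Ioc {ι : Type*} {l : Filter ι} {η : ι → Measure ℝ}
    [∀ i, IsFiniteMeasure (η i)] (hη : ∀ i, ∀ᵐ ω ∂η i, ω ∈ Ioc (-π) π)
    {F : StieltjesFunction ℝ} (hF : ContinuousOn F (Icc (-π) π))
    (h : ∀ k : ℤ, Tendsto (fun i => ∫ ω : ℝ, Complex.exp (-(Complex.I * (k : ℂ) * (ω : ℂ))) ∂η i) l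
      (𝓝 (∫ ω in Ioc (-π) π, Complex.exp (-(Complex.I * (k : ℂ) * (ω : ℂ))) ∂F.measure)))
    {a b : ℝ} (ha : -π ≤ a) (hab : a ≤ b) (hb : b ≤ π) {c : ℝ} (hc : c < F b - F a) :
    ∀ᶠ i in l, c < (η i).real (Ioc a b) := by
  rcases hab.eq_or_lt with rfl | hab
  · exact Eventually.of_forall fun i => by simpa using hc
  have hfin : IsFiniteMeasure (F.measure.restrict (Ioc (-π) π)) :=
    ⟨by simp [StieltjesFunction.measure_Ioc]⟩
  have hlim : Tendsto (fun d => F (b - d) - F (a + d)) (𝓝[>] 0) (𝓝 (F b - F a)) := by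
    -- The limit is taken within `[-π, π]` because `F` is only known to be continuous there.
    have t1 : Tendsto (fun d : ℝ => b - d) (𝓝[>] 0) (𝓝[Icc (-π) π] b) := by
      refine tendsto_nhdsWithin_iff.2 ⟨?_, ?_⟩
      · have : Continuous fun d : ℝ => b - d := by fun_prop
        simpa using (this.tendsto 0).mono_left nhdsWithin_le_nhds
      · filter_upwards [Ioo_mem_nhdsGT (sub_pos.2 hab)] with d hd
        exact ⟨by linarith [hd.2], by linarith [hd.1]⟩
    have t2 : Tendsto (fun d : ℝ => a + d) (𝓝[>] 0) (𝓝[Icc (-π) π] a) := by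
      refine tendsto_nhdsWithin_iff.2 ⟨?_, ?_⟩
      · have : Continuous fun d : ℝ => a + d := by fun_prop
        simpa using (this.tendsto 0).mono_left nhdsWithin_le_nhds
      · filter_upwards [Ioo_mem_nhdsGT (sub_pos.2 hab)] with d hd
        exact ⟨by linarith [hd.1], by linarith [hd.2]⟩
    exact ((hF b ⟨by linarith, hb⟩).tendsto.comp t1).sub
      ((hF a ⟨ha, by linarith⟩).tendsto.comp t2)
  -- The bound `d < (b - a) / 2` keeps `a + d` below `b - d`.
  obtain ⟨d, hdc, hd0, hd⟩ := ((hlim.eventually_const_lt hc).and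
    (Ioo_mem_nhdsGT (half_pos (sub_pos.2 hab)))).exists
  have hν : F (b - d) - F (a + d) ≤
      ∫ ω, trapezoid a b d ω ∂(F.measure.restrict (Ioc (-π) π)) := by
    refine le_trans (le_of_eq ?_) (le_integral_trapezoid _ a b hd0)
    rw [measureReal_restrict_apply measurableSet_Ioc, inter_eq_left.2
      (Ioc_subset_Ioc (by linarith) (by linarith)), measureReal_def, StieltjesFunction.measure_Ioc,
      ENNReal.toReal_ofReal (sub_nonneg.2 (F.mono (by linarith)))]
  filter_upwards [(tendsto_integral_trapezoid hη (ae_restrict_mem measurableSet_Ioc) h ha hb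
    d).eventually_const_lt (hdc.trans_le hν)] with i hi
  exact hi.trans_le (integral_trapezoid_le _ a b hd0)

end SpectralQuantile

end

noncomputable section

namespace SpectralQuantile

open Topology

variable {Ω : Type*} [MeasurableSpace Ω]

/-! ### Convergence in probability as convergence along a filter -/

/-- The filter of convergence in `μ`-measure for sequences of (not necessarily measurable)
functions: a set belongs to it if the measure of the complement of its `n`th slice tends to `0`. -/
def inMeasure (μ : Measure Ω) : Filter (ℕ × Ω) where
  sets := {S | Tendsto (fun n => μ {w | (n, w) ∉ S}) atTop (𝓝 0)}
  univ_sets := by simp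
  sets_of_superset := by
    intro S T hS hST
    exact tendsto_of_tendsto_of_tendsto_of_le_of_le tendsto_const_nhds hS (fun _ => zero_le)
      (fun n => measure_mono fun w hw h => hw (hST h))
  inter_sets := by
    intro S T hS hT
    have h : Tendsto (fun n => μ {w | (n, w) ∉ S} + μ {w | (n, w) ∉ T}) atTop (𝓝 0) := by
      simpa using Tendsto.add hS hT
    refine tendsto_of_tendsto_of_tendsto_of_le_of_le tendsto_const_nhds h (fun _ => zero_le)
      (fun n => (measure_mono fun w hw => ?_).trans (measure_union_le _ _))
    by_contra hc
    simp only [mem_union, mem_ofPred_eq, not_or, not_not] at hc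
    exact hw hc

theorem eventually_inMeasure {μ : Measure Ω} {P : ℕ × Ω → Prop} :
    (∀ᶠ q in inMeasure μ, P q) ↔ Tendsto (fun n => μ {w | ¬ P (n, w)}) atTop (𝓝 0) :=
  Iff.rfl

theorem tendsto_fst_inMeasure (μ : Measure Ω) :
    Tendsto (Prod.fst : ℕ × Ω → ℕ) (inMeasure μ) atTop := by
  intro S hS
  change ∀ᶠ q in inMeasure μ, q.1 ∈ S
  rw [eventually_inMeasure]
  refine tendsto_const_nhds.congr' ?_
  filter_upwards [hS] with n hn
  simp [mem_preimage.1 hn]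

/-! ### Sample autocovariances -/

/-- The times `k` such that both `k` and `k + h` belong to the sample `1, …, n`. -/
def lagIndices (n : ℕ) (h : ℤ) : Finset ℤ :=
  (Finset.Icc 1 (n : ℤ)).filter (fun k => k + h ∈ Finset.Icc 1 (n : ℤ))

theorem card_lagIndices_le (n : ℕ) (h : ℤ) : (lagIndices n h).card ≤ n :=
  (Finset.card_filter_le _ _).trans (by simp)

theorem le_card_lagIndices (n : ℕ) (h : ℤ) : (n : ℝ) - 2 * |(h : ℝ)| ≤ (lagIndices n h).card := by
  -- Cutting `|h|` times off each end of the sample is crude but covers both signs of `h`.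
  have hsub : Finset.Icc (1 + |h|) ((n : ℤ) - |h|) ⊆ lagIndices n h := by
    intro k hk
    have h1 := neg_abs_le h
    have h2 := le_abs_self h
    simp only [lagIndices, Finset.mem_filter, Finset.mem_Icc] at hk ⊢
    omega
  have hc := Finset.card_le_card hsub
  rw [Int.card_Icc] at hc
  have h3 : (n : ℤ) - 2 * |h| ≤ (lagIndices n h).card := by omega
  exact_mod_cast h3

/-- The sample autocovariance at lag `h`. -/
def sampleAutocov (X : ℤ → Ω → ℝ) (h : ℤ) (q : ℕ × Ω) : ℝ :=
  (q.1 : ℝ)⁻¹ * ∑ k ∈ lagIndices q.1 h, X k q.2 * X (k + h) q.2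

theorem tendsto_card_lagIndices_div (h : ℤ) :
    Tendsto (fun n : ℕ => (n : ℝ)⁻¹ * (lagIndices n h).card) atTop (𝓝 1) := by
  have hlow : Tendsto (fun n : ℕ => 1 - (n : ℝ)⁻¹ * (2 * |(h : ℝ)|)) atTop (𝓝 1) := by
    simpa using ((tendsto_inv_atTop_nhds_zero_nat (𝕜 := ℝ)).mul_const (2 * |(h : ℝ)|)).const_sub 1
  refine tendsto_of_tendsto_of_tendsto_of_le_of_le' hlow tendsto_const_nhds ?_ ?_
  · filter_upwards [eventually_ge_atTop 1] with n hn
    have hn : (0 : ℝ) < n := by exact_mod_cast hn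
    have := mul_le_mul_of_nonneg_left (le_card_lagIndices n h) (inv_pos.2 hn).le
    rw [mul_sub, inv_mul_cancel₀ hn.ne'] at this
    exact this
  · filter_upwards [eventually_ge_atTop 1] with n hn
    have hn : (0 : ℝ) < n := by exact_mod_cast hn
    rw [inv_mul_le_iff₀ hn, mul_one]
    exact_mod_cast card_lagIndices_le n h

variable {μ : Measure Ω} {X : ℤ → Ω → ℝ}

/-- Chebyshev: the sum has second moment at most `n * C`, so its mean exceeds `δ` with probability
at most `C / (n * δ ^ 2)`. -/
theorem HasSummableCumulants.tendsto_centered_mean [IsProbabilityMeasure μ]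
    (hX : HasSummableCumulants μ X) (h : ℤ) :
    Tendsto (fun q : ℕ × Ω => (q.1 : ℝ)⁻¹ *
      ∑ k ∈ lagIndices q.1 h, (X k q.2 * X (k + h) q.2 - autocov μ X h)) (inMeasure μ) (𝓝 0) := by
  obtain ⟨C, hC⟩ := hX.exists_integral_sq_sum_le h
  -- The bound for a one-element index set shows that `C` is nonnegative.
  have hC0 : 0 ≤ C := by
    have h1 := (integral_nonneg fun w => sq_nonneg _).trans (hC {0})
    simpa using h1
  rw [Metric.tendsto_nhds]
  intro δ hδ
  rw [eventually_inMeasure]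
  have hlim : Tendsto (fun n : ℕ => ENNReal.ofReal ((n : ℝ)⁻¹ * (C / δ ^ 2))) atTop (𝓝 0) := by
    have := ENNReal.tendsto_ofReal
      ((tendsto_inv_atTop_nhds_zero_nat (𝕜 := ℝ)).mul_const (C / δ ^ 2))
    simpa using this
  refine tendsto_of_tendsto_of_tendsto_of_le_of_le' tendsto_const_nhds hlim
    (Eventually.of_forall fun _ => zero_le) ?_
  filter_upwards [eventually_ge_atTop 1] with n hn
  have hn : (0 : ℝ) < n := by exact_mod_cast hn
  set T : Ω → ℝ := fun w => ∑ k ∈ lagIndices n h, (X k w * X (k + h) w - autocov μ X h) with hT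
  have hL2 : MemLp T 2 μ := memLp_finsetSum _ fun k _ =>
    (hX.memLp_mul k (k + h)).sub (memLp_const _)
  have hmarkov := mul_meas_ge_le_integral_of_nonneg (μ := μ) (f := fun w => T w ^ 2)
    (ae_of_all _ fun w => sq_nonneg _) hL2.integrable_sq ((n * δ) ^ 2)
  have hbound : ∫ w, T w ^ 2 ∂μ ≤ n * C :=
    (hC _).trans (mul_le_mul_of_nonneg_right (by exact_mod_cast card_lagIndices_le n h) hC0)
  have hsub : {w | ¬ dist ((n : ℝ)⁻¹ * T w) 0 < δ} ⊆ {w | (n * δ) ^ 2 ≤ T w ^ 2} := by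
    intro w hw
    simp only [mem_ofPred_eq, not_lt, dist_zero_right, Real.norm_eq_abs, abs_mul,
      abs_of_pos (inv_pos.2 hn)] at hw ⊢
    rw [← div_eq_inv_mul, le_div_iff₀ hn] at hw
    rw [← sq_abs (T w)]
    exact pow_le_pow_left₀ (by positivity) (by linarith) 2
  refine (measure_mono hsub).trans ?_
  rw [← ofReal_measureReal]
  refine ENNReal.ofReal_le_ofReal ?_
  have h1 := hmarkov.trans hbound
  rw [mul_comm, ← le_div_iff₀ (by positivity)] at h1
  refine h1.trans (le_of_eq ?_)
  field_simp

/-- The sample autocovariances are consistent. -/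
theorem HasSummableCumulants.tendsto_sampleAutocov [IsProbabilityMeasure μ]
    (hX : HasSummableCumulants μ X) (h : ℤ) :
    Tendsto (sampleAutocov X h) (inMeasure μ) (𝓝 (autocov μ X h)) := by
  have h1 := (hX.tendsto_centered_mean h).add
    (((tendsto_card_lagIndices_div h).comp (tendsto_fst_inMeasure μ)).mul_const (autocov μ X h))
  rw [zero_add, one_mul] at h1
  refine h1.congr fun q => ?_
  simp only [sampleAutocov, Function.comp_apply, Finset.sum_sub_distrib, Finset.sum_const,
    nsmul_eq_mul]
  ring

/-! ### The periodogram as a measure -/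

theorem continuous_periodogram (X : ℤ → Ω → ℝ) (n : ℕ) (w : Ω) :
    Continuous (periodogram X n w) := by
  unfold periodogram
  fun_prop

theorem periodogram_nonneg (X : ℤ → Ω → ℝ) (n : ℕ) (w : Ω) (ω : ℝ) :
    0 ≤ periodogram X n w ω := by
  unfold periodogram
  positivity

/-- The measure on `(-π, π]` whose density is the periodogram. -/
def periodogramMeasure (X : ℤ → Ω → ℝ) (q : ℕ × Ω) : Measure ℝ :=
  (volume.restrict (Ioc (-π) π)).withDensity
    (fun ω => ENNReal.ofReal (periodogram X q.1 q.2 ω))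

instance isFiniteMeasure_periodogramMeasure (X : ℤ → Ω → ℝ) (q : ℕ × Ω) :
    IsFiniteMeasure (periodogramMeasure X q) :=
  isFiniteMeasure_withDensity_ofReal
    (((continuous_periodogram X q.1 q.2).integrableOn_Icc (a := -π) (b := π)).mono_set
      Ioc_subset_Icc_self).2

theorem ae_periodogramMeasure_mem (X : ℤ → Ω → ℝ) (q : ℕ × Ω) :
    ∀ᵐ ω ∂periodogramMeasure X q, ω ∈ Ioc (-π) π :=
  (withDensity_absolutelyContinuous _ _).ae_le (ae_restrict_mem measurableSet_Ioc)

theorem integral_periodogramMeasure {E : Type*} [NormedAddCommGroup E] [NormedSpace ℝ E]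
    (X : ℤ → Ω → ℝ) (q : ℕ × Ω) (g : ℝ → E) :
    ∫ ω, g ω ∂periodogramMeasure X q = ∫ ω in (-π)..π, periodogram X q.1 q.2 ω • g ω := by
  rw [periodogramMeasure, integral_withDensity_eq_integral_toReal_smul
    (continuous_periodogram X q.1 q.2).measurable.ennreal_ofReal (ae_of_all _ fun _ => by simp),
    intervalIntegral.integral_of_le (by linarith [Real.pi_pos])]
  simp_rw [ENNReal.toReal_ofReal (periodogram_nonneg X q.1 q.2 _)]

theorem integral_exp_int_mul (m : ℤ) :
    ∫ ω in (-π)..π, Complex.exp (Complex.I * (m : ℂ) * (ω : ℂ))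
      = if m = 0 then (2 * π : ℂ) else 0 := by
  split_ifs with hm
  · subst hm
    simp
    ring
  · have hc : Complex.I * (m : ℂ) ≠ 0 := by simp [hm]
    rw [integral_exp_mul_complex hc]
    have : Complex.exp (Complex.I * m * (π : ℝ)) = Complex.exp (Complex.I * m * ((-π : ℝ) : ℂ)) := by
      rw [Complex.exp_eq_exp_iff_exists_int]
      refine ⟨m, ?_⟩
      push_cast
      ring
    rw [this, sub_self, zero_div]

theorem periodogram_eq_sum (X : ℤ → Ω → ℝ) (n : ℕ) (w : Ω) (ω : ℝ) :
    (periodogram X n w ω : ℂ) = ((2 * π * n : ℝ) : ℂ)⁻¹ *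
      ∑ j ∈ Finset.Icc 1 (n : ℤ), ∑ k ∈ Finset.Icc 1 (n : ℤ),
        ((X j w * X k w : ℝ) : ℂ) * Complex.exp (Complex.I * ((j - k : ℤ) : ℂ) * (ω : ℂ)) := by
  have hcast : ∑ j ∈ Finset.Icc 1 n, (X (j : ℤ) w : ℂ) * Complex.exp (Complex.I * (j : ℂ) * (ω : ℂ))
      = ∑ j ∈ Finset.Icc 1 (n : ℤ), (X j w : ℂ) * Complex.exp (Complex.I * (j : ℂ) * (ω : ℂ)) := by
    have : Finset.Icc 1 (n : ℤ) = (Finset.Icc 1 n).image (Nat.cast : ℕ → ℤ) := by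
      apply Finset.coe_injective
      simpa using (Nat.image_cast_int_Icc 1 n).symm
    rw [this, Finset.sum_image (by simp)]
    simp
  rw [periodogram, hcast, Complex.ofReal_mul, ← Complex.normSq_eq_norm_sq,
    Complex.normSq_eq_conj_mul_self, mul_comm ((starRingEnd ℂ) _), map_sum, Finset.sum_mul_sum]
  congr 1
  · push_cast
    ring
  · refine Finset.sum_congr rfl fun j _ => Finset.sum_congr rfl fun k _ => ?_
    have e : Complex.exp (Complex.I * ((j - k : ℤ) : ℂ) * (ω : ℂ))
        = Complex.exp (Complex.I * (j : ℂ) * (ω : ℂ)) *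
          Complex.exp (-(Complex.I * (k : ℂ) * (ω : ℂ))) := by
      rw [← Complex.exp_add]
      congr 1
      push_cast
      ring
    rw [e, map_mul, ← Complex.exp_conj]
    simp only [map_mul, Complex.conj_I, Complex.conj_ofReal, map_intCast, Complex.ofReal_mul]
    rw [neg_mul, neg_mul]
    ring

/-- The Fourier coefficients of the periodogram are the sample autocovariances. -/
theorem fourier_periodogramMeasure (X : ℤ → Ω → ℝ) (q : ℕ × Ω) (h : ℤ) :
    ∫ ω : ℝ, Complex.exp (-(Complex.I * (h : ℂ) * (ω : ℂ))) ∂periodogramMeasure X q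
      = (sampleAutocov X h q : ℂ) := by
  obtain ⟨n, w⟩ := q
  rw [integral_periodogramMeasure]
  have e : ∀ ω : ℝ, periodogram X n w ω • Complex.exp (-(Complex.I * (h : ℂ) * (ω : ℂ)))
      = ((2 * π * n : ℝ) : ℂ)⁻¹ *
      ∑ j ∈ Finset.Icc 1 (n : ℤ), ∑ k ∈ Finset.Icc 1 (n : ℤ),
        ((X j w * X k w : ℝ) : ℂ) *
          Complex.exp (Complex.I * ((j - k - h : ℤ) : ℂ) * (ω : ℂ)) := by
    intro ω
    rw [Complex.real_smul, periodogram_eq_sum, mul_assoc, Finset.sum_mul]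
    congr 1
    refine Finset.sum_congr rfl fun j _ => ?_
    rw [Finset.sum_mul]
    refine Finset.sum_congr rfl fun k _ => ?_
    rw [mul_assoc, ← Complex.exp_add]
    congr 2
    push_cast
    ring
  simp_rw [e]
  have hcont : ∀ (a : ℂ) (m : ℤ), IntervalIntegrable
      (fun ω : ℝ => a * Complex.exp (Complex.I * (m : ℂ) * (ω : ℂ))) volume (-π) π :=
    fun a m => Continuous.intervalIntegrable (by fun_prop) _ _
  rw [intervalIntegral.integral_const_mul, intervalIntegral.integral_finsetSum (fun j _ =>
    Continuous.intervalIntegrable (by fun_prop) _ _)]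
  -- Orthogonality leaves only `j = k + h`. Summing over `j` first then leaves the condition that `k
  -- + h` lies in the sample, which is `lagIndices`.
  have e2 : ∀ j : ℤ, ∫ ω in (-π)..π, ∑ k ∈ Finset.Icc 1 (n : ℤ),
      ((X j w * X k w : ℝ) : ℂ) * Complex.exp (Complex.I * ((j - k - h : ℤ) : ℂ) * (ω : ℂ))
      = ∑ k ∈ Finset.Icc 1 (n : ℤ),
        if j = k + h then ((X k w * X (k + h) w : ℝ) : ℂ) * (2 * π) else 0 := by
    intro j
    rw [intervalIntegral.integral_finsetSum (fun k _ => hcont _ _)]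
    refine Finset.sum_congr rfl fun k _ => ?_
    rw [intervalIntegral.integral_const_mul, integral_exp_int_mul]
    by_cases hjk : j = k + h
    · subst hjk
      simp [mul_comm (X k w)]
    · have : j - k - h ≠ 0 := fun h' => hjk (by linarith)
      simp [hjk, this]
  simp_rw [e2]
  rw [Finset.sum_comm]
  simp_rw [Finset.sum_ite_eq']
  rw [← Finset.sum_filter, sampleAutocov, ← lagIndices, ← Finset.sum_mul]
  have hpi : (π : ℂ) ≠ 0 := by exact_mod_cast Real.pi_ne_zero
  push_cast
  -- For `n = 0` both sides vanish since the inverse of `0` is `0`.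
  by_cases hn : (n : ℂ) = 0
  · simp [hn]
  · field_simp

/-! ### The check function -/

/-- A linear term plus a maximum: continuity and convexity are now visible. -/
theorem checkFn_eq (p u : ℝ) : checkFn p u = p * u + max (-u) 0 := by
  unfold checkFn
  split_ifs with h
  · rw [max_eq_left (by linarith)]
    ring
  · rw [max_eq_right (by linarith)]
    ring

theorem continuous_checkFn (p : ℝ) : Continuous (checkFn p) := by
  have : checkFn p = fun u => p * u + max (-u) 0 := funext (checkFn_eq p)
  rw [this]
  fun_prop

/-- Subgradient inequality for `θ ↦ ρ_p(ω - θ)` at `x`. -/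
theorem checkFn_subgradient (p θ x ω : ℝ) :
    (θ - x) * ((Iic x).indicator 1 ω - p) ≤ checkFn p (ω - θ) - checkFn p (ω - x) := by
  rw [checkFn_eq, checkFn_eq]
  have h1 := le_max_left (-(ω - θ)) 0
  have h2 := le_max_right (-(ω - θ)) 0
  by_cases h : ω ≤ x
  · rw [indicator_of_mem (mem_Iic.2 h), max_eq_left (by linarith : 0 ≤ -(ω - x))]
    simp only [Pi.one_apply]
    linarith
  · rw [indicator_of_notMem (by simpa using h), max_eq_right (by linarith : -(ω - x) ≤ 0)]
    linarith

/-- The pointwise subgradient inequality is integrated. Concentration on `(-π, π]` makes the check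
function integrable and turns `Iic x` into `Ioc (-π) x`. -/
theorem integral_checkFn_subgradient {η : Measure ℝ} [IsFiniteMeasure η]
    (hη : ∀ᵐ ω ∂η, ω ∈ Ioc (-π) π) (p θ x : ℝ) :
    (θ - x) * (η.real (Ioc (-π) x) - p * η.real univ)
      ≤ ∫ ω, checkFn p (ω - θ) ∂η - ∫ ω, checkFn p (ω - x) ∂η := by
  have hint : ∀ θ, Integrable (fun ω => checkFn p (ω - θ)) η := by
    intro θ
    have hc : Continuous (fun ω => checkFn p (ω - θ)) := (continuous_checkFn p).comp (by fun_prop)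
    obtain ⟨C, hC⟩ := (isCompact_Icc (a := -π) (b := π)).exists_bound_of_continuousOn
      hc.continuousOn
    refine Integrable.of_bound hc.aestronglyMeasurable C ?_
    filter_upwards [hη] with ω hω using hC ω (Ioc_subset_Icc_self hω)
  have hind : Integrable ((Iic x).indicator (1 : ℝ → ℝ)) η :=
    (integrable_indicator_iff measurableSet_Iic).2 (integrableOn_const (by finiteness))
  have hIic : η.real (Iic x) = η.real (Ioc (-π) x) := by
    refine measureReal_congr ?_
    filter_upwards [hη] with ω hω
    refine propext ⟨fun h => ⟨hω.1, h⟩, fun h => h.2⟩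
  rw [← integral_sub (hint θ) (hint x)]
  refine le_trans (le_of_eq ?_) (integral_mono ((hind.sub (integrable_const p)).const_mul (θ - x))
    ((hint θ).sub (hint x)) (fun ω => checkFn_subgradient p θ x ω))
  rw [integral_const_mul]
  congr 1
  have := integral_sub hind (integrable_const p)
  simp only [Pi.sub_apply]
  rw [this, integral_indicator_one measurableSet_Iic, hIic, integral_const, smul_eq_mul, mul_comm p]

theorem empiricalObjective_eq (X : ℤ → Ω → ℝ) (p : ℝ) (n : ℕ) (w : Ω) (θ : ℝ) :
    empiricalObjective X p n w θ = ∫ ω, checkFn p (ω - θ) ∂periodogramMeasure X (n, w) := by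
  rw [integral_periodogramMeasure, empiricalObjective]
  simp_rw [smul_eq_mul, mul_comm]

/-- First order condition for a minimizer of the empirical objective. -/
theorem IsQuantileEstimator.mul_le_zero {p : ℝ} {est : ℕ → Ω → ℝ}
    (hest : IsQuantileEstimator X p est) {q : ℕ × Ω} (hq : 1 ≤ q.1) {x : ℝ}
    (hx : x ∈ Icc (-π) π) :
    (est q.1 q.2 - x) * ((periodogramMeasure X q).real (Ioc (-π) x)
      - p * (periodogramMeasure X q).real univ) ≤ 0 := by
  have h1 := integral_checkFn_subgradient (ae_periodogramMeasure_mem X q) p (est q.1 q.2) x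
  have h2 := isMinOn_iff.1 (hest q.1 hq q.2).2 x hx
  rw [empiricalObjective_eq, empiricalObjective_eq] at h2
  exact h1.trans (sub_nonpos.2 h2)

/-! ### Consistency -/

section Consistency

variable [IsProbabilityMeasure μ] {F : StieltjesFunction ℝ}

theorem HasSummableCumulants.tendsto_fourier_periodogramMeasure (hX : HasSummableCumulants μ X)
    (hF : IsSpectralDistribution (autocov μ X) F) (k : ℤ) :
    Tendsto (fun q => ∫ ω : ℝ, Complex.exp (-(Complex.I * (k : ℂ) * (ω : ℂ)))
      ∂periodogramMeasure X q) (inMeasure μ)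
      (𝓝 (∫ ω in Ioc (-π) π, Complex.exp (-(Complex.I * (k : ℂ) * (ω : ℂ))) ∂F.measure)) := by
  rw [← hF.fourier k]
  simp_rw [fourier_periodogramMeasure]
  exact (Complex.continuous_ofReal.tendsto _).comp (hX.tendsto_sampleAutocov k)

/-- Lag `0` of the Fourier representation identifies the normalizing constant with the total
spectral mass. -/
theorem IsSpectralDistribution.apply_pi {R : ℤ → ℝ} (hF : IsSpectralDistribution R F) :
    F π = R 0 := by
  have h := hF.fourier 0
  simp only [Int.cast_zero, mul_zero, zero_mul, neg_zero, Complex.exp_zero, integral_const,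
    measureReal_restrict_apply MeasurableSet.univ, univ_inter, Complex.real_smul, mul_one,
    measureReal_def, StieltjesFunction.measure_Ioc, hF.left_end, sub_zero] at h
  have h0 : 0 ≤ F π := hF.left_end ▸ F.mono (by linarith [Real.pi_pos])
  rw [ENNReal.toReal_ofReal h0] at h
  exact_mod_cast h.symm

theorem IsSpectralDensity.continuousOn {f : ℝ → ℝ} (hf : IsSpectralDensity F f) :
    ContinuousOn F (Icc (-π) π) := by
  have hpi : -π ≤ π := by linarith [Real.pi_pos]
  have h := intervalIntegral.continuousOn_primitive_interval (a := -π) (b := π) (f := f)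
    (μ := volume) (by rw [uIcc_of_le hpi]; exact hf.integrable)
  rw [uIcc_of_le hpi] at h
  exact h.congr hf.integral_eq

theorem HasSummableCumulants.tendsto_mass (hX : HasSummableCumulants μ X)
    (hF : IsSpectralDistribution (autocov μ X) F) :
    Tendsto (fun q => (periodogramMeasure X q).real univ) (inMeasure μ) (𝓝 (F π)) := by
  rw [hF.apply_pi]
  refine (hX.tendsto_sampleAutocov 0).congr fun q => ?_
  have := fourier_periodogramMeasure X q 0
  simp only [Int.cast_zero, mul_zero, zero_mul, neg_zero, Complex.exp_zero, integral_const,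
    Complex.real_smul, mul_one] at this
  exact_mod_cast this.symm

/-- A constant `c` strictly between `p * F π` and `F x` eventually separates `p` times the total
mass from the mass of `(-π, x]`. The subgradient at `x` is then positive, which rules out a
minimizer to the right of `x`. -/
theorem HasSummableCumulants.eventually_est_le (hX : HasSummableCumulants μ X)
    (hF : IsSpectralDistribution (autocov μ X) F) (hFc : ContinuousOn F (Icc (-π) π))
    {p : ℝ} {est : ℕ → Ω → ℝ} (hest : IsQuantileEstimator X p est) {x : ℝ}
    (hx : x ∈ Icc (-π) π) (hpx : p * F π < F x) :
    ∀ᶠ q in inMeasure μ, est q.1 q.2 ≤ x := by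
  obtain ⟨c, hc1, hc2⟩ := exists_between hpx
  filter_upwards [(tendsto_fst_inMeasure μ).eventually_ge_atTop 1,
    ((hX.tendsto_mass hF).const_mul p).eventually_lt_const hc1,
    eventually_lt_measureReal_Ioc (ae_periodogramMeasure_mem X) hFc
      (hX.tendsto_fourier_periodogramMeasure hF) le_rfl hx.1 hx.2
      (by rwa [hF.left_end, sub_zero] : c < F x - F (-π))] with q h1 h2 h3
  have h := hest.mul_le_zero h1 hx
  by_contra! hlt
  exact absurd h (not_le.2 (mul_pos (sub_pos.2 hlt) (by linarith)))

theorem HasSummableCumulants.eventually_le_est (hX : HasSummableCumulants μ X)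
    (hF : IsSpectralDistribution (autocov μ X) F) (hFc : ContinuousOn F (Icc (-π) π))
    {p : ℝ} {est : ℕ → Ω → ℝ} (hest : IsQuantileEstimator X p est) {x : ℝ}
    (hx : x ∈ Icc (-π) π) (hpx : F x < p * F π) :
    ∀ᶠ q in inMeasure μ, x ≤ est q.1 q.2 := by
  -- An upper bound for the mass of `(-π, x]` is needed here. It comes from a lower bound for `(x,
  -- π]`: more than the fraction `1 - p` of the mass there leaves less than `p` on the left.
  obtain ⟨c, hc1, hc2⟩ := exists_between (by linarith : (1 - p) * F π < F π - F x)
  filter_upwards [(tendsto_fst_inMeasure μ).eventually_ge_atTop 1,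
    ((hX.tendsto_mass hF).const_mul (1 - p)).eventually_lt_const hc1,
    eventually_lt_measureReal_Ioc (ae_periodogramMeasure_mem X) hFc
      (hX.tendsto_fourier_periodogramMeasure hF) hx.1 hx.2 le_rfl hc2] with q h1 h2 h3
  have h := hest.mul_le_zero h1 hx
  have hsplit : (periodogramMeasure X q).real univ
      = (periodogramMeasure X q).real (Ioc (-π) x) + (periodogramMeasure X q).real (Ioc x π) := by
    rw [← measureReal_union (Ioc_disjoint_Ioc_of_le le_rfl) measurableSet_Ioc,
      Ioc_union_Ioc_eq_Ioc hx.1 hx.2]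
    refine measureReal_congr ?_
    filter_upwards [ae_periodogramMeasure_mem X q] with ω hω
    exact propext ⟨fun _ => hω, fun _ => trivial⟩
  by_contra! hlt
  exact absurd h (not_le.2 (mul_pos_of_neg_of_neg (sub_neg.2 hlt) (by linarith)))

end Consistency

end SpectralQuantile

end

theorem theorem3p2 {Ω : Type*} [MeasurableSpace Ω] (μ : Measure Ω) [IsProbabilityMeasure μ]
    (X : ℤ → Ω → ℝ) (hX : SpectralQuantile.HasSummableCumulants μ X)
    (hpos : 0 < SpectralQuantile.autocov μ X 0)
    (F : StieltjesFunction ℝ)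
    (hF : SpectralQuantile.IsSpectralDistribution (SpectralQuantile.autocov μ X) F)
    (f : ℝ → ℝ) (hf : SpectralQuantile.IsSpectralDensity F f)
    (α : ℝ≥0) (hα : 1 / 2 < (α : ℝ))
    (hLip : ∃ C : ℝ≥0, HolderOnWith C α f (Icc (-π) π))
    (p : ℝ) (hp0 : 0 ≤ p) (hp1 : p ≤ 1)
    -- the `p`th quantile is unambiguous: the normalized spectral distribution function exceeds `p`
    -- to the right of it
    (huniq : ∀ ω ∈ Ioc (SpectralQuantile.quantile F (SpectralQuantile.autocov μ X 0) p) π,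
      p < F ω * (SpectralQuantile.autocov μ X 0)⁻¹)
    (est : ℕ → Ω → ℝ) (hest : SpectralQuantile.IsQuantileEstimator X p est) :
    TendstoInMeasure μ est atTop
      (fun _ => SpectralQuantile.quantile F (SpectralQuantile.autocov μ X 0) p) := by
  have hFc := hf.continuousOn
  have hpi : -π ≤ π := by linarith [Real.pi_pos]
  rw [← hF.apply_pi] at huniq hpos ⊢
  set lam := SpectralQuantile.quantile F (F π) p with hlam
  -- The set defining the quantile is nonempty because `p ≤ 1`.
  have hmem : π ∈ {ω : ℝ | ω ∈ Icc (-π) π ∧ p ≤ F ω * (F π)⁻¹} :=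
    ⟨⟨hpi, le_rfl⟩, by rwa [mul_inv_cancel₀ hpos.ne']⟩
  have hbdd : BddBelow {ω : ℝ | ω ∈ Icc (-π) π ∧ p ≤ F ω * (F π)⁻¹} :=
    ⟨-π, fun ω hω => hω.1.1⟩
  have hlam1 : -π ≤ lam := le_csInf ⟨π, hmem⟩ fun ω hω => hω.1.1
  have hlam2 : lam ≤ π := csInf_le hbdd hmem
  rw [tendstoInMeasure_iff_dist]
  intro ε hε
  suffices h : ∀ᶠ q in SpectralQuantile.inMeasure μ, dist (est q.1 q.2) lam < ε by
    simpa using SpectralQuantile.eventually_inMeasure.1 h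
  have hest_mem : ∀ᶠ q in SpectralQuantile.inMeasure μ, est q.1 q.2 ∈ Icc (-π) π := by
    filter_upwards [(SpectralQuantile.tendsto_fst_inMeasure μ).eventually_ge_atTop 1] with q hq
    exact (hest q.1 hq q.2).1
  have hup : ∀ᶠ q in SpectralQuantile.inMeasure μ, est q.1 q.2 ≤ lam + ε / 2 := by
    by_cases hx : lam + ε / 2 ≤ π
    -- Unambiguity supplies the strict inequality to the right of `lam`; to the left it follows from
    -- `lam` being an infimum. Points outside `[-π, π]` need no argument beyond the range of the
    -- estimator.
    · have h := huniq (lam + ε / 2) ⟨by linarith, hx⟩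
      rw [← div_eq_mul_inv, lt_div_iff₀ hpos] at h
      exact hX.eventually_est_le hF hFc hest ⟨by linarith, hx⟩ h
    · filter_upwards [hest_mem] with q hq
      linarith [hq.2]
  have hlow : ∀ᶠ q in SpectralQuantile.inMeasure μ, lam - ε / 2 ≤ est q.1 q.2 := by
    by_cases hx : -π ≤ lam - ε / 2
    · have hxI : lam - ε / 2 ∈ Icc (-π) π := ⟨hx, by linarith⟩
      have h : F (lam - ε / 2) * (F π)⁻¹ < p := by
        by_contra! hc
        have : lam ≤ lam - ε / 2 := csInf_le hbdd ⟨hxI, hc⟩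
        linarith
      rw [← div_eq_mul_inv, div_lt_iff₀ hpos] at h
      exact hX.eventually_le_est hF hFc hest hxI h
    · filter_upwards [hest_mem] with q hq
      linarith [hq.1]
  filter_upwards [hup, hlow] with q h1 h2
  rw [Real.dist_eq, abs_lt]
  constructor <;> linarith
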